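/- Throughout, a distribution $F$ is a probability distribution on $\mathbb{R}$ with unbounded support contained in $[0,\infty)$, $\overline F(x)=F((x,\infty))$ is its tail, $F^{*2}=F*F$, and all limits are as $x\to\infty$ unless indicated otherwise. For positive functions, $g\sim h$ means $g/h\to1$, and $g\approx h$ means $g=O(h)$ and $h=O(g)$; $F$ is weakly tail equivalent to $F_1$ if $\overline F\approx\overline{F_1}$. Let $\mathcal J$ be the class of distributions $F$ such that for all $n\ge2$, with $X_1,\dots,X_n$ i.i.d. of law $F$, $$\lim_{K\to\infty}\liminf_{x\to\infty}\mathbb P\Big(\max_{1\le i\le n}X_i>x-K\ \Big|\ X_1+\dots+X_n>x\Big)=1 .$$ Let $\mathcal K$ be the class of heavy-tailed distributions, i.e. $\int_0^\infty e^{\lambda y}F(dy)=\infty$ for all $\lambda>0$, and $\mathcal K^c$ its complement (the light-tailed distributions). Let $\mathcal S=\mathcal S(0)$ be the class of $F$ with $\overline{F^{*2}}(x)\sim2\overline F(x)$. For $\gamma>0$ let $\mathcal S(\gamma)$ be the class of $F$ such that $\overline F(x+t)\sim e^{-\gamma t}\overline F(x)$ for all $t\ne0$, $\int_0^\infty e^{\gamma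 y}F(dy)<\infty$, and $\overline{F^{*2}}(x)\sim2\int_0^\infty e^{\gamma y}F(dy)\,\overline F(x)$. Let $\mathcal J(\mathcal K^c)_1$ be the set of $F\in\mathcal J\cap\mathcal K^c$ that are weakly tail equivalent to some $F_1\in\mathcal S(\gamma)$ for some $\gamma>0$, and $\mathcal J(\mathcal K^c)_2=(\mathcal J\cap\mathcal K^c)\setminus\mathcal J(\mathcal K^c)_1$. Let $\mathcal J(\mathcal K)_1$ be the set of $F\in\mathcal J\cap\mathcal K$ that are weakly tail equivalent to some $F_1\in\mathcal S$, and $\mathcal J(\mathcal K)_2=(\mathcal J\cap\mathcal K)\setminus\mathcal J(\mathcal K)_1$. Put $\mathcal J_i=\mathcal J(\mathcal K)_i\cup\mathcal J(\mathcal K^c)_i$ for $i=1,2$. **Theorem 1.1.** (i) $\mathcal J\cap\mathcal K^c$ is the disjoint union of $\mathcal J(\mathcal K^c)_1$ and $\mathcal J(\mathcal K^c)_2$, and $\mathcal J(\mathcal K^c)_i\setminus\bigcup_{\beta>0}\mathcal S(\beta)\ne\emptyset$ for $i=1,2$. In particular, the conjecture of Beck et al. that $\mathcal J=(\mathcal J\cap\mathcal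 K)\cup\bigcup_{\beta>0}\mathcal S(\beta)$ is false. (ii) $\mathcal J$ is the disjoint union of $\mathcal J_1$ and $\mathcal J_2$, and $\mathcal J_i\setminus\bigcup_{\beta\ge0}\mathcal S(\beta)\ne\emptyset$ for $i=1,2$. -/

import Mathlib

open MeasureTheory ProbabilityTheory Filter Set Asymptotics
open scoped Topology ENNReal

noncomputable section

namespace BigJump

/-- A probability distribution on the line whose support is unbounded and contained
in `[0, ∞)`. -/
structure Law where
  /-- The distribution as a measure. -/
  law : Measure ℝ
  isProbabilityMeasure : IsProbabilityMeasure law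
  support_nonneg : law (Iio 0) = 0
  support_unbounded : ∀ x : ℝ, 0 < law (Ioi x)

attribute [instance] Law.isProbabilityMeasure

/-- The tail `x ↦ F (x, ∞)`, that is one minus the distribution function. -/
def Law.tail (F : Law) (x : ℝ) : ℝ := F.law.real (Ioi x)

/-- The tail of the two-fold convolution `F * F`. -/
def Law.tailConv (F : Law) (x : ℝ) : ℝ := (Measure.conv F.law F.law).real (Ioi x)

/-- The class `𝒥`: for every `n ≥ 2`, if `X₁, …, Xₙ` are i.i.d. with law `F` (here the
coordinates `ω i` under the product measure), then
`lim_{K → ∞} liminf_{x → ∞} P (max Xᵢ > x - K ∣ X₁ + ⋯ + Xₙ > x) = 1`. -/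
def classJ : Set Law :=
  {F | ∀ n : ℕ, 2 ≤ n →
    Tendsto
      (fun K : ℝ => liminf
        (fun x : ℝ =>
          cond (Measure.pi fun _ : Fin n => F.law) {ω | x < ∑ i, ω i} {ω | x - K < ⨆ i, ω i})
        atTop)
      atTop (𝓝 (1 : ℝ≥0∞))}

/-- The class `𝒦` of heavy-tailed distributions: all exponential moments are infinite. -/
def classK : Set Law :=
  {F | ∀ r : ℝ, 0 < r → ∫⁻ y, ENNReal.ofReal (Real.exp (r * y)) ∂F.law = ⊤}

/-- The class `𝒮` of subexponential distributions. -/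
def subexponential : Set Law :=
  {F | F.tailConv ~[atTop] fun x => 2 * F.tail x}

/-- The exponential class `ℒ(γ)` (meant for `γ > 0`). -/
def classL (γ : ℝ) : Set Law :=
  {F | ∀ t : ℝ, t ≠ 0 →
    (fun x => F.tail (x + t)) ~[atTop] fun x => Real.exp (-γ * t) * F.tail x}

/-- The convolution equivalent class `𝒮(γ)` for `γ > 0`. -/
def convolutionEquivalent (γ : ℝ) : Set Law :=
  {F | F ∈ classL γ ∧ Integrable (fun y => Real.exp (γ * y)) F.law ∧
    F.tailConv ~[atTop] fun x => 2 * (∫ y, Real.exp (γ * y) ∂F.law) * F.tail x}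

/-- The classes `𝒮(β)` for `β ≥ 0`, where `𝒮(0) = 𝒮`. -/
def classS (β : ℝ) : Set Law :=
  if β = 0 then subexponential else convolutionEquivalent β

/-- Weak tail equivalence: each tail is `O` of the other. -/
def WeaklyTailEquivalent (F G : Law) : Prop := F.tail =Θ[atTop] G.tail

/-- `𝒥(𝒦ᶜ)₁`: the light-tailed members of `𝒥` that are weakly tail equivalent to some member
of some `𝒮(γ)`, `γ > 0`. -/
def classJLight₁ : Set Law :=
  classJ ∩ classKᶜ ∩ {F | ∃ γ : ℝ, 0 < γ ∧ ∃ F₁ ∈ classS γ, WeaklyTailEquivalent F F₁}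

/-- `𝒥(𝒦ᶜ)₂`: the other light-tailed members of `𝒥`. -/
def classJLight₂ : Set Law := (classJ ∩ classKᶜ) \ classJLight₁

/-- `𝒥(𝒦)₁`: the heavy-tailed members of `𝒥` that are weakly tail equivalent to some
subexponential distribution. -/
def classJHeavy₁ : Set Law :=
  classJ ∩ classK ∩ {F | ∃ F₁ ∈ subexponential, WeaklyTailEquivalent F F₁}

/-- `𝒥(𝒦)₂`: the other heavy-tailed members of `𝒥`. -/
def classJHeavy₂ : Set Law := (classJ ∩ classK) \ classJHeavy₁

/-- The class `𝒥₁`. -/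
def classJ₁ : Set Law := classJHeavy₁ ∪ classJLight₁

/-- The class `𝒥₂`. -/
def classJ₂ : Set Law := classJHeavy₂ ∪ classJLight₂

end BigJump

end

noncomputable section

namespace BigJump

/-! The decompositions are set algebra; the content is two light-tailed witnesses, which serve both
(i) and (ii). Both are lattice laws with mass proportional to `e⁻ᵏ g k`, where `g` varies
polynomially.

Membership in `𝒥` comes from a bound `p a * p b ≤ w b * p (a + b)` for `b ≤ a` with `w` summable
(`latticeLaw_mem_classJ`). If the sum exceeds `x` while the largest coordinate is at most `x - K`,
the other coordinates sum to more than `K`. Merging them into the largest one costs the product of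
their weights, so this event has probability at most a tail of a convergent series times `P (X >
x)`. For tilted masses the exponentials cancel and only a condition on `g` remains (`IsWeight`).
Such a law is light-tailed, its tail is comparable to the first mass beyond it, and the atom at `1`
keeps it out of `𝒮`.

First witness: `g k = (2 + (-1)ᵏ) / (1 + k)²`. Its tail is comparable to `e⁻ˣ / (1 + x)²`, the tail
of a law in `𝒮(1)`, but the parity oscillation of the masses excludes every `ℒ(γ)`, `γ > 0`
(`tendsto_mass_ratio`).

Second witness: `g k = (1 + d k)² / (1 + k)⁶`, with `d` the distance to the powers of two. Weak
equivalence to a member of `ℒ(γ)` would bound `g (m + t) * g (m - t) / g m ^ 2` for large `m` by a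
constant independent of `t` (`exists_forall_mul_le`), whereas at `m = 2ⁿ` this ratio is at least `(1
+ t)⁴`. -/

/-! ### Laws carried by the natural numbers -/

/-- The law on the line of a natural number with everywhere positive mass function `p`. -/
def latticeLaw (p : PMF ℕ) (hp : ∀ k, p k ≠ 0) : Law where
  law := p.toMeasure.map (fun k : ℕ => (k : ℝ))
  isProbabilityMeasure := Measure.isProbabilityMeasure_map (by fun_prop)
  support_nonneg := by
    rw [Measure.map_apply (by fun_prop) measurableSet_Iio]
    have : (fun k : ℕ => (k : ℝ)) ⁻¹' Iio 0 = ∅ := by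
      ext k
      simp
    rw [this, measure_empty]
  support_unbounded x := by
    rw [Measure.map_apply (by fun_prop) measurableSet_Ioi]
    obtain ⟨k, hk⟩ := exists_nat_gt x
    calc 0 < p k := pos_iff_ne_zero.2 (hp k)
      _ = p.toMeasure {k} := (p.toMeasure_apply_singleton k (measurableSet_singleton k)).symm
      _ ≤ _ := measure_mono (by simpa using hk)

variable {p : PMF ℕ} {hp : ∀ k, p k ≠ 0}

theorem latticeLaw_apply {s : Set ℝ} (hs : MeasurableSet s) :
    (latticeLaw p hp).law s = p.toMeasure ((fun k : ℕ => (k : ℝ)) ⁻¹' s) :=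
  Measure.map_apply (by fun_prop) hs

/-- The factors are absorbed one at a time into the largest index. The running sum never drops below
`a`, so each new index is still the smaller of the two and the hypothesis applies. -/
theorem prod_le_of_mul_le {ι : Type*} {f w : ℕ → ℝ≥0∞}
    (h : ∀ a b, b ≤ a → f a * f b ≤ w b * f (a + b)) (a : ℕ) (r : ι → ℕ) (s : Finset ι)
    (hr : ∀ j ∈ s, r j ≤ a) :
    f a * ∏ j ∈ s, f (r j) ≤ (∏ j ∈ s, w (r j)) * f (a + ∑ j ∈ s, r j) := by
  classical
  induction s using Finset.induction_on with
  | empty => simp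
  | insert i s hi ih =>
    rw [Finset.prod_insert hi, Finset.prod_insert hi, Finset.sum_insert hi]
    have ih := ih fun j hj => hr j (Finset.mem_insert_of_mem hj)
    have hia : r i ≤ a + ∑ j ∈ s, r j :=
      (hr i (Finset.mem_insert_self i s)).trans (Nat.le_add_right _ _)
    calc f a * (f (r i) * ∏ j ∈ s, f (r j)) = (f a * ∏ j ∈ s, f (r j)) * f (r i) := by ring
      _ ≤ ((∏ j ∈ s, w (r j)) * f (a + ∑ j ∈ s, r j)) * f (r i) := by gcongr
      _ = (∏ j ∈ s, w (r j)) * (f (a + ∑ j ∈ s, r j) * f (r i)) := by ring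
      _ ≤ (∏ j ∈ s, w (r j)) * (w (r i) * f (a + ∑ j ∈ s, r j + r i)) :=
        mul_le_mul_right (h _ _ hia) _
      _ = _ := by
        rw [show a + ∑ j ∈ s, r j + r i = a + (r i + ∑ j ∈ s, r j) by ring]
        ring

/-- The mass that the `n`-fold power of the weight `w` gives to vectors with sum beyond `K`. -/
def powerTail (w : ℕ → ℝ≥0∞) (n : ℕ) (K : ℝ) : ℝ≥0∞ :=
  ∑' r : Fin n → ℕ, {r : Fin n → ℕ | K < ∑ j, (r j : ℝ)}.indicator (fun r => ∏ j, w (r j)) r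

/-- The summable weight is a finite measure on `ℕ`, so this is continuity from above for its finite
product measure. -/
theorem tendsto_powerTail {w : ℕ → ℝ≥0∞} (hw : ∑' k, w k ≠ ⊤) (n : ℕ) :
    Tendsto (powerTail w n) atTop (𝓝 0) := by
  set ω : Measure ℕ := Measure.count.withDensity w with hω
  have : IsFiniteMeasure ω := isFiniteMeasure_withDensity (by simpa [lintegral_count] using hw)
  have hsing : ∀ k, ω {k} = w k := fun k => by
    rw [hω, withDensity_apply _ (measurableSet_singleton k), lintegral_singleton,
      Measure.count_singleton, mul_one]
  have key : powerTail w n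
      = (Measure.pi fun _ : Fin n => ω) ∘ fun K : ℝ => {r | K < ∑ j, (r j : ℝ)} := by
    funext K
    rw [Function.comp_apply, ← Measure.tsum_indicator_apply_singleton _ _
      (Set.to_countable _).measurableSet, powerTail]
    simp only [Measure.pi_singleton, hsing]
  rw [key]
  have hempty : (⋂ K : ℝ, {r : Fin n → ℕ | K < ∑ j, (r j : ℝ)}) = ∅ := by
    ext r
    simp only [mem_iInter, mem_ofPred_eq, mem_empty_iff_false, iff_false, not_forall, not_lt]
    exact ⟨_, le_rfl⟩
  rw [← measure_empty (μ := Measure.pi fun _ : Fin n => ω), ← hempty]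
  exact tendsto_measure_iInter_atTop
    (fun K => (Set.to_countable _).measurableSet.nullMeasurableSet)
    (fun K L h r hr => lt_of_le_of_lt h hr) ⟨0, measure_ne_top _ _⟩

/-- Write a configuration as its maximal value `a` and the remaining vector `r`. The constraints
force the entries of `r` to sum to more than `K`. For fixed `r`, the map `a ↦ a + ∑ r` is injective,
so the merged masses sum to at most `P (X > x)`. -/
theorem pi_argmax_le {w : ℕ → ℝ≥0∞} (h : ∀ a b, b ≤ a → p a * p b ≤ w b * p (a + b))
    (n : ℕ) (i : Fin (n + 1)) (K x : ℝ) :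
    (Measure.pi fun _ : Fin (n + 1) => p.toMeasure)
        {k | x < ∑ j, (k j : ℝ) ∧ (∀ j, k j ≤ k i) ∧ (k i : ℝ) ≤ x - K}
      ≤ powerTail w n K * p.toMeasure {m | x < (m : ℝ)} := by
  rw [← Measure.tsum_indicator_apply_singleton _ _ (Set.to_countable _).measurableSet,
    ← (Fin.insertNthEquiv (fun _ => ℕ) i).tsum_eq, ENNReal.tsum_prod', ENNReal.tsum_comm,
    powerTail, ← ENNReal.tsum_mul_right]
  refine ENNReal.tsum_le_tsum fun r => ?_
  calc _ ≤ ∑' a : ℕ, {r : Fin n → ℕ | K < ∑ j, (r j : ℝ)}.indicator (fun r => ∏ j, w (r j)) r *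
        {m : ℕ | x < (m : ℝ)}.indicator p (a + ∑ j, r j) := by
        refine ENNReal.tsum_le_tsum fun a => ?_
        rw [indicator_apply]
        split_ifs with hk
        · obtain ⟨h1, h2, h3⟩ := hk
          rw [Fin.sum_univ_succAbove _ i] at h1
          simp only [Fin.insertNthEquiv_apply, Fin.insertNth_apply_same,
            Fin.insertNth_apply_succAbove] at h1 h2 h3
          rw [indicator_of_mem (by simp only [mem_ofPred_eq]; linarith),
            indicator_of_mem (by simp only [mem_ofPred_eq]; push_cast; linarith),
            Measure.pi_singleton, Fin.prod_univ_succAbove _ i]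
          simp only [Fin.insertNthEquiv_apply, Fin.insertNth_apply_same,
            Fin.insertNth_apply_succAbove,
            p.toMeasure_apply_singleton _ (measurableSet_singleton _)]
          refine prod_le_of_mul_le h a r Finset.univ fun j _ => ?_
          simpa using h2 (i.succAbove j)
        · exact zero_le
    _ ≤ _ := by
        rw [ENNReal.tsum_mul_left, p.toMeasure_apply (Set.to_countable _).measurableSet]
        refine mul_le_mul_right ?_ _
        exact ENNReal.tsum_comp_le_tsum_of_injective (f := fun a : ℕ => a + ∑ j, r j)
          (add_left_injective _) _

theorem pi_no_big_jump_le {w : ℕ → ℝ≥0∞} (h : ∀ a b, b ≤ a → p a * p b ≤ w b * p (a + b))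
    (n : ℕ) (K x : ℝ) :
    (Measure.pi fun _ : Fin (n + 1) => (latticeLaw p hp).law)
        ({ω | x < ∑ i, ω i} ∩ {ω | x - K < ⨆ i, ω i}ᶜ)
      ≤ ((n + 1 : ℕ) * powerTail w n K) *
        (Measure.pi fun _ : Fin (n + 1) => (latticeLaw p hp).law) {ω | x < ∑ i, ω i} := by
  have hmap : (Measure.pi fun _ : Fin (n + 1) => (latticeLaw p hp).law)
      = (Measure.pi fun _ : Fin (n + 1) => p.toMeasure).map (fun k i => (k i : ℝ)) := by
    have : ∀ i : Fin (n + 1), SigmaFinite (p.toMeasure.map (fun k : ℕ => (k : ℝ))) := fun i =>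
      inferInstanceAs (SigmaFinite (latticeLaw p hp).law)
    exact (Measure.pi_map_pi (fun _ => by fun_prop)).symm
  have hsum : MeasurableSet {ω : Fin (n + 1) → ℝ | x < ∑ i, ω i} :=
    measurableSet_lt measurable_const (by fun_prop)
  have hsup : MeasurableSet {ω : Fin (n + 1) → ℝ | x - K < ⨆ i, ω i} :=
    measurableSet_lt measurable_const (Measurable.iSup fun i => measurable_pi_apply i)
  rw [hmap, Measure.map_apply (by fun_prop) (hsum.inter hsup.compl),
    Measure.map_apply (by fun_prop) hsum]
  have hsub : (fun (k : Fin (n + 1) → ℕ) i => (k i : ℝ)) ⁻¹'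
        ({ω | x < ∑ i, ω i} ∩ {ω | x - K < ⨆ i, ω i}ᶜ)
      ⊆ ⋃ i, {k | x < ∑ j, (k j : ℝ) ∧ (∀ j, k j ≤ k i) ∧ (k i : ℝ) ≤ x - K} := by
    rintro k ⟨h1, h2⟩
    obtain ⟨i, hi⟩ := Finite.exists_max k
    simp only [mem_compl_iff, mem_ofPred_eq, not_lt] at h2
    exact mem_iUnion.2 ⟨i, h1, hi, (le_ciSup (Set.finite_range _).bddAbove i).trans h2⟩
  -- The coordinates are nonnegative, so one of them exceeding `x` already makes the sum exceed `x`.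
  -- This turns the bound into one relative to the conditioning event, uniform in `x`.
  have hone : p.toMeasure {m | x < (m : ℝ)} ≤ (Measure.pi fun _ : Fin (n + 1) => p.toMeasure)
      ((fun (k : Fin (n + 1) → ℕ) i => (k i : ℝ)) ⁻¹' {ω | x < ∑ i, ω i}) := by
    rw [← (measurePreserving_eval (fun _ : Fin (n + 1) => p.toMeasure) 0).measure_preimage
      (Set.to_countable _).measurableSet.nullMeasurableSet]
    refine measure_mono fun k hk => ?_
    simp only [mem_preimage, mem_ofPred_eq, Function.eval] at hk ⊢
    exact hk.trans_le
      (Finset.single_le_sum (f := fun i => (k i : ℝ)) (fun i _ => by positivity) (Finset.mem_univ 0))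
  calc _ ≤ _ := measure_mono hsub
    _ ≤ ∑ i, (Measure.pi fun _ : Fin (n + 1) => p.toMeasure)
        {k | x < ∑ j, (k j : ℝ) ∧ (∀ j, k j ≤ k i) ∧ (k i : ℝ) ≤ x - K} := by
      exact measure_iUnion_fintype_le _ _
    _ ≤ ∑ i : Fin (n + 1), powerTail w n K * p.toMeasure {m | x < (m : ℝ)} :=
      Finset.sum_le_sum fun i _ => pi_argmax_le h n i K x
    _ = ((n + 1 : ℕ) * powerTail w n K) * p.toMeasure {m | x < (m : ℝ)} := by
      simp [mul_assoc]
    _ ≤ _ := by gcongr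

/-- A lattice law is in `𝒥` as soon as the product of two point masses is bounded by the mass of
the sum, times a summable weight of the smaller point. -/
theorem latticeLaw_mem_classJ {w : ℕ → ℝ≥0∞} (hw : ∑' k, w k ≠ ⊤)
    (h : ∀ a b, b ≤ a → p a * p b ≤ w b * p (a + b)) : latticeLaw p hp ∈ classJ := by
  intro n hn
  obtain ⟨n, rfl⟩ : ∃ m, n = m + 1 := ⟨n - 1, by omega⟩
  set P : Measure (Fin (n + 1) → ℝ) := Measure.pi fun _ => (latticeLaw p hp).law with hP
  have hsum : ∀ x, MeasurableSet {ω : Fin (n + 1) → ℝ | x < ∑ i, ω i} := fun x =>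
    measurableSet_lt measurable_const (by fun_prop)
  have hpos : ∀ x, P {ω | x < ∑ i, ω i} ≠ 0 := by
    intro x
    have hb : 0 < P (univ.pi fun _ => Ioi |x|) := by
      rw [hP, Measure.pi_pi]
      exact CanonicallyOrderedAdd.prod_pos.2 fun i _ => (latticeLaw p hp).support_unbounded _
    refine (hb.trans_le (measure_mono fun ω hω => ?_)).ne'
    have hω : ∀ i, |x| < ω i := by simpa using hω
    exact ((le_abs_self x).trans_lt (hω 0)).trans_le (Finset.single_le_sum
      (fun i _ => (abs_nonneg x).trans (hω i).le) (Finset.mem_univ 0))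
  have hlow : ∀ K x : ℝ, 1 - (n + 1 : ℕ) * powerTail w n K ≤
      cond P {ω | x < ∑ i, ω i} {ω | x - K < ⨆ i, ω i} := by
    intro K x
    have hsup : MeasurableSet {ω : Fin (n + 1) → ℝ | x - K < ⨆ i, ω i} :=
      measurableSet_lt measurable_const (Measurable.iSup fun i => measurable_pi_apply i)
    have : IsProbabilityMeasure (cond P {ω | x < ∑ i, ω i}) := cond_isProbabilityMeasure (hpos x)
    rw [← compl_compl {ω : Fin (n + 1) → ℝ | x - K < ⨆ i, ω i},
      prob_compl_eq_one_sub hsup.compl]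
    refine tsub_le_tsub_left ?_ 1
    rw [cond_apply (hsum x), mul_comm, ← div_eq_mul_inv]
    exact ENNReal.div_le_of_le_mul (pi_no_big_jump_le h n K x)
  have hlim : Tendsto (fun K : ℝ => 1 - (n + 1 : ℕ) * powerTail w n K) atTop (𝓝 (1 : ℝ≥0∞)) := by
    have h0 := ENNReal.Tendsto.const_mul (tendsto_powerTail hw n)
      (Or.inr (ENNReal.natCast_ne_top (n + 1)))
    rw [mul_zero] at h0
    simpa using ENNReal.Tendsto.sub (tendsto_const_nhds (x := (1 : ℝ≥0∞))) h0
      (Or.inl ENNReal.one_ne_top)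
  refine tendsto_of_tendsto_of_tendsto_of_le_of_le hlim tendsto_const_nhds (fun K => ?_)
    (fun K => ?_)
  · exact le_liminf_of_le (by isBoundedDefault) (Eventually.of_forall fun x => hlow K x)
  · refine (liminf_le_liminf (v := fun _ => 1) (Eventually.of_forall fun x => ?_)).trans_eq
      (liminf_const _)
    have : IsProbabilityMeasure (cond P {ω | x < ∑ i, ω i}) := cond_isProbabilityMeasure (hpos x)
    exact prob_le_one

namespace Law

theorem tail_pos (F : Law) (x : ℝ) : 0 < F.tail x :=
  ENNReal.toReal_pos (F.support_unbounded x).ne' (measure_ne_top _ _)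

theorem ae_nonneg (F : Law) : ∀ᵐ a ∂F.law, 0 ≤ a := by
  rw [ae_iff]
  simpa [Iio_def] using F.support_nonneg

theorem tendsto_tail (F : Law) : Tendsto F.tail atTop (𝓝 0) := by
  have h : Tendsto (fun x : ℝ => F.law (Ioi x)) atTop (𝓝 (F.law (⋂ x : ℝ, Ioi x))) :=
    tendsto_measure_iInter_atTop (fun x => measurableSet_Ioi.nullMeasurableSet)
      (fun x y hxy => Ioi_subset_Ioi hxy) ⟨0, measure_ne_top _ _⟩
  have he : (⋂ x : ℝ, Ioi x) = ∅ := by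
    ext y
    simp only [mem_iInter, mem_Ioi, mem_empty_iff_false, iff_false, not_forall, not_lt]
    exact ⟨y, le_rfl⟩
  rw [he, measure_empty] at h
  have h0 := (ENNReal.continuousAt_toReal ENNReal.zero_ne_top).tendsto.comp h
  rwa [ENNReal.toReal_zero] at h0

end Law

/-! ### Exponentially tilted lattice laws -/

theorem summable_sq_mul_exp {r : ℝ} (hr : 0 < r) :
    Summable fun k : ℕ => (1 + k : ℝ) ^ 2 * Real.exp (-r * k) := by
  have h := (Real.summable_pow_mul_exp_neg_nat_mul 2 hr).comp_injective
    (add_left_injective 1)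
  refine (h.mul_left (Real.exp r)).congr fun k => ?_
  have : Real.exp (-r * k) = Real.exp r * Real.exp (-r * (k + 1 : ℝ)) := by
    rw [← Real.exp_add]
    ring_nf
  simp only [Function.comp_apply, Nat.cast_add, Nat.cast_one, this]
  ring

/-- Positive sequences whose exponential tilt `k ↦ e⁻ᵏ g k` satisfies the single big jump
principle: `g` has controlled growth, and `g a * g b` is controlled by `g (a + b)`. -/
structure IsWeight (g : ℕ → ℝ) (B : ℝ) : Prop where
  pos : ∀ k, 0 < g k
  growth : ∀ m j : ℕ, g (m + j) ≤ B * (1 + j) ^ 2 * g m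
  mul_le : ∀ a b : ℕ, b ≤ a → g a * g b ≤ B * ((1 + b : ℝ) ^ 2)⁻¹ * g (a + b)

namespace IsWeight

variable {g : ℕ → ℝ} {B : ℝ}

theorem const_pos (h : IsWeight g B) : 0 < B := by
  have h1 := h.growth 0 0
  have h2 := h.pos 0
  simp only [add_zero, Nat.cast_zero, one_pow, mul_one] at h1
  by_contra hB
  nlinarith

theorem mul_exp_le (h : IsWeight g B) (m j : ℕ) :
    Real.exp (-(m + j : ℕ)) * g (m + j)
      ≤ Real.exp (-m) * g m * (B * ((1 + j : ℝ) ^ 2 * Real.exp (-1 * j))) := by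
  have : Real.exp (-((m + j : ℕ) : ℝ)) = Real.exp (-m) * Real.exp (-1 * j) := by
    rw [← Real.exp_add]
    push_cast
    ring_nf
  rw [this]
  calc _ ≤ Real.exp (-m) * Real.exp (-1 * j) * (B * (1 + j) ^ 2 * g m) := by
        gcongr
        exact h.growth m j
    _ = _ := by ring

theorem le_zero_mul (h : IsWeight g B) (k : ℕ) : g k ≤ B * (1 + k) ^ 2 * g 0 := by
  simpa using h.growth 0 k

theorem summable_exp (h : IsWeight g B) {r : ℝ} (hr : 0 < r) :
    Summable fun k : ℕ => Real.exp (-r * k) * g k := by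
  refine Summable.of_nonneg_of_le (fun k => ?_) (fun k => ?_)
    ((summable_sq_mul_exp hr).mul_left (B * g 0))
  · have := h.pos k
    positivity
  · calc _ ≤ Real.exp (-r * k) * (B * (1 + k) ^ 2 * g 0) := by
          gcongr
          exact h.le_zero_mul k
      _ = _ := by ring

/-- The normalising constant of the mass function `k ↦ e⁻ᵏ g k`. -/
def total (_ : IsWeight g B) : ℝ := ∑' k : ℕ, Real.exp (-k) * g k

theorem summable (h : IsWeight g B) : Summable fun k : ℕ => Real.exp (-k) * g k := by
  simpa using h.summable_exp one_pos

theorem term_pos (h : IsWeight g B) (k : ℕ) : 0 < Real.exp (-k) * g k :=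
  mul_pos (Real.exp_pos _) (h.pos k)

theorem total_pos (h : IsWeight g B) : 0 < h.total :=
  h.summable.tsum_pos (fun k => (h.term_pos k).le) 0 (h.term_pos 0)

/-- The normalised mass function proportional to `k ↦ e⁻ᵏ g k`. -/
def mass (h : IsWeight g B) (k : ℕ) : ℝ := Real.exp (-k) * g k / h.total

theorem mass_pos (h : IsWeight g B) (k : ℕ) : 0 < h.mass k := div_pos (h.term_pos k) h.total_pos

theorem hasSum_mass (h : IsWeight g B) : HasSum h.mass 1 := by
  have := h.summable.hasSum.div_const h.total
  rwa [show (∑' k : ℕ, Real.exp (-k) * g k) = h.total from rfl, div_self h.total_pos.ne'] at this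

/-- The probability mass function proportional to `k ↦ e⁻ᵏ g k`. -/
def pmf (h : IsWeight g B) : PMF ℕ :=
  ⟨fun k => ENNReal.ofReal (h.mass k), by
    have h1 := ENNReal.ofReal_tsum_of_nonneg (fun k => (h.mass_pos k).le) h.hasSum_mass.summable
    rw [h.hasSum_mass.tsum_eq, ENNReal.ofReal_one] at h1
    exact h1 ▸ ENNReal.summable.hasSum⟩

theorem pmf_apply (h : IsWeight g B) (k : ℕ) : h.pmf k = ENNReal.ofReal (h.mass k) := rfl

theorem pmf_ne_zero (h : IsWeight g B) (k : ℕ) : h.pmf k ≠ 0 := by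
  simpa [pmf_apply] using h.mass_pos k

/-- The lattice law with mass function proportional to `k ↦ e⁻ᵏ g k`. -/
def toLaw (h : IsWeight g B) : Law := latticeLaw h.pmf h.pmf_ne_zero

/-- The factor `e⁻ᵏ` is multiplicative and cancels. Two normalising constants on the left against
one on the right leave the weight `B / total * (1 + b)⁻²`, which is summable. -/
theorem toLaw_mem_classJ (h : IsWeight g B) : h.toLaw ∈ classJ := by
  have hs : Summable fun b : ℕ => B / h.total * ((1 + b : ℝ) ^ 2)⁻¹ := by
    refine Summable.mul_left _ ?_
    have := (summable_nat_add_iff 1).2 (Real.summable_nat_pow_inv.2 one_lt_two)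
    simpa [add_comm] using this
  have hB := h.const_pos
  have hZ := h.total_pos
  refine latticeLaw_mem_classJ
    (w := fun b => ENNReal.ofReal (B / h.total * ((1 + b : ℝ) ^ 2)⁻¹)) ?_ fun a b hab => ?_
  · rw [← ENNReal.ofReal_tsum_of_nonneg (fun b => by positivity) hs]
    exact ENNReal.ofReal_ne_top
  · rw [pmf_apply, pmf_apply, pmf_apply, ← ENNReal.ofReal_mul (h.mass_pos a).le,
      ← ENNReal.ofReal_mul (by positivity)]
    refine ENNReal.ofReal_le_ofReal ?_
    have he : Real.exp (-((a + b : ℕ) : ℝ)) = Real.exp (-a) * Real.exp (-b) := by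
      rw [← Real.exp_add]
      push_cast
      ring_nf
    unfold mass
    rw [he]
    calc _ = Real.exp (-a) * Real.exp (-b) / h.total ^ 2 * (g a * g b) := by
          field_simp
      _ ≤ Real.exp (-a) * Real.exp (-b) / h.total ^ 2 *
          (B * ((1 + b : ℝ) ^ 2)⁻¹ * g (a + b)) := by
          exact mul_le_mul_of_nonneg_left (h.mul_le a b hab) (by positivity)
      _ = _ := by field_simp

theorem toLaw_notMem_classK (h : IsWeight g B) : h.toLaw ∉ classK := by
  intro hK
  refine (?_ : _ ≠ ⊤) (hK (1 / 2) (by norm_num))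
  have hs := (h.summable_exp (r := 1 / 2) (by norm_num)).div_const h.total
  have hZ := h.total_pos
  have hint : ∫⁻ y, ENNReal.ofReal (Real.exp (1 / 2 * y)) ∂h.toLaw.law
      = ∑' k : ℕ, ENNReal.ofReal (Real.exp (-(1 / 2) * k) * g k / h.total) := by
    rw [toLaw, latticeLaw, lintegral_map (by fun_prop) (by fun_prop), lintegral_countable']
    refine tsum_congr fun k => ?_
    rw [PMF.toMeasure_apply_singleton _ _ (measurableSet_singleton _), pmf_apply,
      ← ENNReal.ofReal_mul (Real.exp_pos _).le, mass, ← mul_div_assoc, ← mul_assoc,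
      ← Real.exp_add]
    ring_nf
  rw [hint, ← ENNReal.ofReal_tsum_of_nonneg _ hs]
  · exact ENNReal.ofReal_ne_top
  · intro k
    have := h.pos k
    positivity

/-- The constant comparing the tail with the first mass beyond it. -/
def tailConst (_ : IsWeight g B) : ℝ := ∑' j : ℕ, B * ((1 + j : ℝ) ^ 2 * Real.exp (-1 * j))

theorem mass_add_le (h : IsWeight g B) (m j : ℕ) :
    h.mass (m + j) ≤ h.mass m * (B * ((1 + j : ℝ) ^ 2 * Real.exp (-1 * j))) := by
  unfold mass
  rw [div_mul_eq_mul_div]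
  exact div_le_div_of_nonneg_right (h.mul_exp_le m j) h.total_pos.le

theorem tail_eq (h : IsWeight g B) (x : ℝ) :
    h.toLaw.tail x = h.pmf.toMeasure.real {k : ℕ | x < k} := by
  rw [Law.tail, measureReal_def, measureReal_def, toLaw, latticeLaw_apply measurableSet_Ioi]
  rfl

theorem tail_floor (h : IsWeight g B) {x : ℝ} (hx : 0 ≤ x) :
    h.toLaw.tail x = h.toLaw.tail ⌊x⌋₊ := by
  rw [tail_eq, tail_eq]
  congr 1
  ext k
  simp [Nat.floor_lt hx]

theorem tail_eq_add (h : IsWeight g B) (m : ℕ) :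
    h.toLaw.tail m = h.toLaw.tail (m + 1 : ℕ) + h.mass (m + 1) := by
  have hset : {k : ℕ | (m : ℝ) < k} = {k : ℕ | ((m + 1 : ℕ) : ℝ) < k} ∪ {m + 1} := by
    ext k
    simp only [Nat.cast_lt, mem_ofPred_eq, union_singleton, mem_insert_iff]
    omega
  rw [tail_eq, tail_eq, hset, measureReal_union (by simp) (measurableSet_singleton _)]
  congr 1
  rw [measureReal_def, PMF.toMeasure_apply_singleton _ _ (measurableSet_singleton _), pmf_apply,
    ENNReal.toReal_ofReal (h.mass_pos _).le]

theorem mass_le_tail (h : IsWeight g B) (m : ℕ) : h.mass (m + 1) ≤ h.toLaw.tail m := by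
  rw [h.tail_eq_add]
  linarith [h.toLaw.tail_pos (m + 1 : ℕ)]

theorem summable_tailConst (_h : IsWeight g B) :
    Summable fun j : ℕ => B * ((1 + j : ℝ) ^ 2 * Real.exp (-1 * j)) :=
  (summable_sq_mul_exp one_pos).mul_left B

theorem tailConst_pos (h : IsWeight g B) : 0 < h.tailConst := by
  have hB := h.const_pos
  exact h.summable_tailConst.tsum_pos (fun j => by positivity) 0 (by positivity)

/-- Together with `mass_le_tail`, this makes tail and mass interchangeable up to constants, with an
index shift of one. -/
theorem tail_le_mass (h : IsWeight g B) (m : ℕ) :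
    h.toLaw.tail m ≤ h.tailConst * h.mass (m + 1) := by
  have hB := h.const_pos
  have hm := h.mass_pos (m + 1)
  rw [tail_eq, measureReal_def]
  refine ENNReal.toReal_le_of_le_ofReal (mul_pos h.tailConst_pos hm).le ?_
  rw [PMF.toMeasure_apply _ (Set.to_countable _).measurableSet,
    ← (add_right_injective (m + 1)).tsum_eq, mul_comm, tailConst, ← tsum_mul_left,
    ENNReal.ofReal_tsum_of_nonneg (fun j => by positivity) (h.summable_tailConst.mul_left _)]
  · refine ENNReal.tsum_le_tsum fun j => (indicator_le_self' (fun _ _ => zero_le) _).trans ?_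
    exact ENNReal.ofReal_le_ofReal (h.mass_add_le (m + 1) j)
  · intro k hk
    have : m < k := by simpa using (indicator_apply_ne_zero.1 hk).1
    exact ⟨k - (m + 1), by simp only; omega⟩

/-- Three disjoint pieces of `{X + Y > x}` with `x = m + 1`: `X > x`; then `X ≤ x < Y`; and the
single point `X = 1`, `Y = x`. The last piece is an extra contribution of the same order as the
tail. -/
theorem le_tailConv (h : IsWeight g B) (m : ℕ) :
    2 * h.toLaw.tail (m + 1 : ℕ) - h.toLaw.tail (m + 1 : ℕ) ^ 2 + h.mass 1 * h.mass (m + 1)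
      ≤ h.toLaw.tailConv (m + 1 : ℕ) := by
  set μ := h.toLaw.law with hμ
  set x : ℝ := ((m + 1 : ℕ) : ℝ) with hx
  have hatom : ∀ k : ℕ, μ.real {(k : ℝ)} = h.mass k := fun k => by
    have : (fun j : ℕ => (j : ℝ)) ⁻¹' {(k : ℝ)} = {k} := by
      ext j
      simp
    rw [measureReal_def, hμ, toLaw, latticeLaw_apply (measurableSet_singleton _), this,
      PMF.toMeasure_apply_singleton _ _ (measurableSet_singleton _), pmf_apply,
      ENNReal.toReal_ofReal (h.mass_pos _).le]
  have hpos : ∀ᵐ a ∂μ, 0 ≤ a := h.toLaw.ae_nonneg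
  have hIic : μ.real (Iic x) = 1 - h.toLaw.tail x := by
    rw [← compl_Ioi, probReal_compl_eq_one_sub measurableSet_Ioi]
    rfl
  have hx1 : (1 : ℝ) ≤ x := by
    rw [hx]
    push_cast
    linarith [(Nat.cast_nonneg m : (0 : ℝ) ≤ m)]
  have hconv : h.toLaw.tailConv x = (μ.prod μ).real {z | x < z.1 + z.2} := by
    rw [Law.tailConv, measureReal_def, Measure.conv,
      Measure.map_apply (by fun_prop) measurableSet_Ioi]
    rfl
  have hsub : ((Ioi x ×ˢ Ici 0 ∪ Iic x ×ˢ Ioi x) ∪ {((1 : ℕ) : ℝ)} ×ˢ {((m + 1 : ℕ) : ℝ)} :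
      Set (ℝ × ℝ)) ≤ᵐ[μ.prod μ] {z : ℝ × ℝ | x < z.1 + z.2} := by
    have h1 : ∀ᵐ z ∂μ.prod μ, 0 ≤ z.1 := Measure.quasiMeasurePreserving_fst.ae hpos
    filter_upwards [h1] with z hz hz'
    rcases hz' with (⟨ha, hb⟩ | ⟨ha, hb⟩) | ⟨ha, hb⟩
    · exact lt_add_of_lt_of_nonneg ha hb
    · exact lt_add_of_nonneg_of_lt hz hb
    · have ha : z.1 = 1 := by simpa using ha
      have hb : z.2 = x := hb
      show x < z.1 + z.2
      linarith
  have hIci : μ.real (Ici 0) = 1 := by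
    rw [measureReal_def, (mem_ae_iff_prob_eq_one measurableSet_Ici).1 hpos, ENNReal.toReal_one]
  rw [hconv]
  refine le_trans (le_of_eq ?_) (ENNReal.toReal_mono (measure_ne_top _ _) (measure_mono_ae hsub))
  rw [← measureReal_def, measureReal_union _ (by measurability),
    measureReal_union _ (measurableSet_Iic.prod measurableSet_Ioi), measureReal_prod_prod,
    measureReal_prod_prod, measureReal_prod_prod, hIci, hIic, hatom, hatom]
  · change _ = h.toLaw.tail x * 1 + (1 - h.toLaw.tail x) * h.toLaw.tail x + _
    ring
  · rw [Set.disjoint_left]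
    rintro z ⟨ha, -⟩ ⟨hb, -⟩
    exact absurd (mem_Ioi.1 ha) (not_lt.2 (mem_Iic.1 hb))
  · rw [Set.disjoint_left]
    rintro z hz ⟨ha, hb⟩
    have ha : z.1 = 1 := by simpa using ha
    have hb : z.2 = x := hb
    rcases hz with ⟨hc, -⟩ | ⟨-, hc⟩
    · simp only [mem_Ioi] at hc
      linarith
    · simp only [mem_Ioi] at hc
      linarith

/-- Since the tail is at most `tailConst` times the mass, the extra atom keeps the limit of the
ratio at least `1 + mass 1 / (2 * tailConst)`. -/
theorem toLaw_notMem_subexponential (h : IsWeight g B) : h.toLaw ∉ subexponential := by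
  intro hS
  have hS : Tendsto (fun x => h.toLaw.tailConv x / (2 * h.toLaw.tail x)) atTop (𝓝 1) :=
    (isEquivalent_iff_tendsto_one (Eventually.of_forall fun x => by
      have := h.toLaw.tail_pos x
      positivity)).1 hS
  have hnat : Tendsto (fun m : ℕ => ((m + 1 : ℕ) : ℝ)) atTop atTop :=
    tendsto_natCast_atTop_atTop.comp (tendsto_add_atTop_nat 1)
  have hV := h.tailConst_pos
  have hlow : Tendsto (fun m : ℕ => 1 - h.toLaw.tail (m + 1 : ℕ) / 2 + h.mass 1 / h.tailConst / 2)
      atTop (𝓝 (1 - 0 / 2 + h.mass 1 / h.tailConst / 2)) :=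
    (((((h.toLaw.tendsto_tail).comp hnat).div_const 2).const_sub 1).add_const _)
  have := le_of_tendsto_of_tendsto' hlow (hS.comp hnat) fun m => ?_
  · have h1 : 0 < h.mass 1 / h.tailConst := div_pos (h.mass_pos 1) hV
    linarith
  · have hT := h.toLaw.tail_pos (m + 1 : ℕ)
    rw [Function.comp_apply, le_div_iff₀ (by positivity)]
    refine le_trans ?_ (h.le_tailConv m)
    have h1 : h.toLaw.tail (m + 1 : ℕ) ≤ h.tailConst * h.mass (m + 1) := by
      have := h.tail_eq_add m
      linarith [h.mass_pos (m + 1), h.tail_le_mass m]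
    have h2 : h.mass 1 / h.tailConst * h.toLaw.tail (m + 1 : ℕ) ≤ h.mass 1 * h.mass (m + 1) := by
      rw [div_mul_eq_mul_div, div_le_iff₀ hV, mul_assoc]
      refine mul_le_mul_of_nonneg_left ?_ (h.mass_pos 1).le
      linarith
    linarith

end IsWeight

/-! ### Exponential tails and convolution equivalence -/

namespace Law

theorem tail_antitone (F : Law) : Antitone F.tail := fun _ _ h =>
  measureReal_mono (Ioi_subset_Ioi h)

theorem tendsto_tail_div {F : Law} {γ : ℝ} (hF : F ∈ classL γ) (t : ℝ) :
    Tendsto (fun x => F.tail (x + t) / F.tail x) atTop (𝓝 (Real.exp (-γ * t))) := by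
  rcases eq_or_ne t 0 with rfl | ht
  · simp [div_self (F.tail_pos _).ne']
  have h := (isEquivalent_iff_tendsto_one (Eventually.of_forall fun x =>
    (mul_pos (Real.exp_pos (-γ * t)) (F.tail_pos x)).ne')).1 (hF t ht)
  have h2 := h.const_mul (Real.exp (-γ * t))
  rw [mul_one] at h2
  refine h2.congr fun x => ?_
  have := F.tail_pos x
  simp only [Pi.div_apply]
  field_simp

/-- Split `{X + Y > x}` by which summand is at most `x / 2`. Both cannot be, the two one-sided cases
are mirror images, and the remaining case is a square. -/
theorem tailConv_eq (F : Law) (x : ℝ) :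
    F.tailConv x = 2 * ∫ a, (Iic (x / 2)).indicator (fun a => F.tail (x - a)) a ∂F.law
      + F.tail (x / 2) ^ 2 := by
  set μ := F.law with hμ
  set A : Set (ℝ × ℝ) := {z | z.1 ≤ x / 2 ∧ x < z.1 + z.2} with hA
  set A' : Set (ℝ × ℝ) := {z | z.2 ≤ x / 2 ∧ x < z.1 + z.2} with hA'
  have mA : MeasurableSet A :=
    (measurableSet_le measurable_fst measurable_const).inter
      (measurableSet_lt measurable_const (measurable_fst.add measurable_snd))
  have mA' : MeasurableSet A' :=
    (measurableSet_le measurable_snd measurable_const).inter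
      (measurableSet_lt measurable_const (measurable_fst.add measurable_snd))
  have hset : {z : ℝ × ℝ | x < z.1 + z.2} = (A ∪ A') ∪ Ioi (x / 2) ×ˢ Ioi (x / 2) := by
    ext z
    simp only [hA, hA', mem_ofPred_eq, mem_union, mem_prod, mem_Ioi]
    constructor
    · intro h
      by_cases h1 : z.1 ≤ x / 2
      · exact Or.inl (Or.inl ⟨h1, h⟩)
      by_cases h2 : z.2 ≤ x / 2
      · exact Or.inl (Or.inr ⟨h2, h⟩)
      exact Or.inr ⟨not_le.1 h1, not_le.1 h2⟩
    · rintro ((h | h) | h)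
      · exact h.2
      · exact h.2
      · linarith [h.1, h.2]
  have hAint : (μ.prod μ).real A = ∫ a, (Iic (x / 2)).indicator (fun a => F.tail (x - a)) a ∂μ := by
    rw [measureReal_def, Measure.prod_apply mA, ← integral_toReal
      (measurable_measure_prodMk_left mA).aemeasurable
      (Eventually.of_forall fun a => measure_lt_top _ _)]
    refine integral_congr_ae (Eventually.of_forall fun a => ?_)
    by_cases ha : a ≤ x / 2
    · simp only [indicator_of_mem (mem_Iic.2 ha)]
      rw [Law.tail, measureReal_def]
      congr 2
      ext b
      simp only [hA, mem_preimage, mem_ofPred_eq, ha, true_and, mem_Ioi, sub_lt_iff_lt_add']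
    · simp only [indicator_of_notMem (show a ∉ Iic (x / 2) from ha)]
      have : Prod.mk a ⁻¹' A = ∅ := by
        ext b
        simp [hA, ha]
      rw [this, measure_empty, ENNReal.toReal_zero]
  have hswap : (μ.prod μ).real A' = (μ.prod μ).real A := by
    rw [measureReal_def, measureReal_def]
    nth_rewrite 1 [← Measure.prod_swap]
    rw [Measure.map_apply measurable_swap mA']
    congr 2
    ext z
    simp [hA, hA', add_comm]
  have hconv : F.tailConv x = (μ.prod μ).real {z | x < z.1 + z.2} := by
    rw [Law.tailConv, measureReal_def, Measure.conv,
      Measure.map_apply (by fun_prop) measurableSet_Ioi]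
    rfl
  rw [hconv, hset, measureReal_union _ (measurableSet_Ioi.prod measurableSet_Ioi),
    measureReal_union _ mA', hswap, hAint, measureReal_prod_prod]
  · change _ + F.tail (x / 2) * F.tail (x / 2) = _
    ring
  · rw [Set.disjoint_left]
    rintro z ⟨h1, h⟩ ⟨h2, -⟩
    linarith
  · rw [Set.disjoint_left]
    rintro z (⟨h1, -⟩ | ⟨h1, -⟩) ⟨h2, h3⟩
    · exact absurd (mem_Ioi.1 h2) (not_lt.2 h1)
    · exact absurd (mem_Ioi.1 h3) (not_lt.2 h1)

/-- A law with exponential tail is convolution equivalent when its tail has a dominated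
variation after tilting, and the square of the tail at `x / 2` is negligible. -/
theorem mem_convolutionEquivalent {F : Law} {γ C : ℝ} (hF : F ∈ classL γ)
    (hint : Integrable (fun y => Real.exp (γ * y)) F.law)
    (hdom : ∀ x a, 0 ≤ a → a ≤ x / 2 → F.tail (x - a) ≤ C * Real.exp (γ * a) * F.tail x)
    (hsq : Tendsto (fun x => F.tail (x / 2) ^ 2 / F.tail x) atTop (𝓝 0)) :
    F ∈ convolutionEquivalent γ := by
  refine ⟨hF, hint, ?_⟩
  set M := ∫ y, Real.exp (γ * y) ∂F.law with hM
  have hMpos : 0 < M := integral_exp_pos hint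
  have hlim : Tendsto (fun x => ∫ a, (Iic (x / 2)).indicator
      (fun a => F.tail (x - a) / F.tail x) a ∂F.law) atTop (𝓝 M) := by
    -- The ratio `tail (x - a) / tail x` tends to `exp (γ * a)` pointwise by the exponential tail
    -- property; `hdom` supplies the integrable majorant.
    refine tendsto_integral_filter_of_dominated_convergence
      (fun a => |C| * Real.exp (γ * a)) ?_ ?_ (hint.const_mul _) ?_
    · refine Eventually.of_forall fun x => ?_
      refine ((Measurable.indicator ?_ measurableSet_Iic)).aestronglyMeasurable
      exact (F.tail_antitone.measurable.comp (measurable_const.sub measurable_id)).div_const _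
    · refine Eventually.of_forall fun x => ?_
      filter_upwards [F.ae_nonneg] with a ha
      by_cases hax : a ≤ x / 2
      · rw [indicator_of_mem (mem_Iic.2 hax), Real.norm_of_nonneg
          (div_pos (F.tail_pos _) (F.tail_pos _)).le, div_le_iff₀ (F.tail_pos _)]
        refine (hdom x a ha hax).trans ?_
        gcongr
        · exact (F.tail_pos x).le
        · exact le_abs_self C
      · rw [indicator_of_notMem (show a ∉ Iic (x / 2) from hax), norm_zero]
        positivity
    · refine Eventually.of_forall fun a => ?_
      have h := tendsto_tail_div hF (-a)
      rw [neg_mul_neg] at h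
      refine h.congr' ?_
      filter_upwards [eventually_ge_atTop (2 * a)] with x hx
      rw [indicator_of_mem (mem_Iic.2 (by linarith)), ← sub_eq_add_neg]
  have hmain := ((hlim.const_mul 2).add hsq).div_const (2 * M)
  rw [add_zero, div_self (by positivity)] at hmain
  refine (isEquivalent_iff_tendsto_one (Eventually.of_forall fun x =>
    (mul_pos (mul_pos two_pos hMpos) (F.tail_pos x)).ne')).2 (hmain.congr fun x => ?_)
  have hx := F.tail_pos x
  have hind : ∀ a, (Iic (x / 2)).indicator (fun a => F.tail (x - a) / F.tail x) a
      = (Iic (x / 2)).indicator (fun a => F.tail (x - a)) a / F.tail x := fun a => by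
    by_cases ha : a ∈ Iic (x / 2) <;> simp [ha]
  simp only [Pi.div_apply, F.tailConv_eq x, hind, integral_div]
  field_simp

/-- For `F₁` the factors `exp (-γ * t)` and `exp (γ * t)` cancel, so the analogous ratio tends to
`1`. Weak equivalence loses only its own constants, so `C` is chosen before `t`; this order of
quantifiers is what the second witness violates. -/
theorem exists_forall_tail_mul_le {F F₁ : Law} {γ : ℝ} (hF₁ : F₁ ∈ classL γ)
    (h : WeaklyTailEquivalent F F₁) :
    ∃ C : ℝ, 0 < C ∧ ∀ t : ℝ, ∀ᶠ x in atTop, F.tail (x + t) * F.tail (x - t) ≤ C * F.tail x ^ 2 := by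
  obtain ⟨c, hc, hFc⟩ := h.1.exists_pos
  obtain ⟨d, hd, hFd⟩ := h.2.exists_pos
  refine ⟨2 * c ^ 2 * d ^ 2, by positivity, fun t => ?_⟩
  have hlim := (tendsto_tail_div hF₁ t).mul (tendsto_tail_div hF₁ (-t))
  rw [← Real.exp_add, show -γ * t + -γ * -t = 0 by ring, Real.exp_zero] at hlim
  have hp := tendsto_atTop_add_const_right atTop t tendsto_id
  have hm := tendsto_atTop_add_const_right atTop (-t) tendsto_id
  filter_upwards [hlim.eventually_lt_const one_lt_two, hp.eventually hFc.bound,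
    hm.eventually hFc.bound, hFd.bound] with x h1 h2 h3 h4
  simp only [id, Real.norm_of_nonneg (tail_pos _ _).le, ← sub_eq_add_neg] at h1 h2 h3 h4
  have hx := F₁.tail_pos x
  rw [div_mul_div_comm, div_lt_iff₀ (by positivity)] at h1
  calc F.tail (x + t) * F.tail (x - t) ≤ (c * F₁.tail (x + t)) * (c * F₁.tail (x - t)) :=
        mul_le_mul h2 h3 (F.tail_pos _).le ((F.tail_pos _).le.trans h2)
    _ = c ^ 2 * (F₁.tail (x + t) * F₁.tail (x - t)) := by ring
    _ ≤ c ^ 2 * (2 * (F₁.tail x * F₁.tail x)) := by gcongr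
    _ ≤ c ^ 2 * (2 * ((d * F.tail x) * (d * F.tail x))) := by
        have := hx.le.trans h4
        gcongr
    _ = _ := by ring

end Law

/-! ### A convolution equivalent law with tail `e⁻ˣ / (1 + x)²` -/

/-- The function `x ↦ e⁻ˣ / (1 + x)²`. -/
def expSqTail (x : ℝ) : ℝ := Real.exp (-x) / (1 + x) ^ 2

/-- Minus the derivative of `expSqTail`. -/
def expSqDensity (x : ℝ) : ℝ := Real.exp (-x) * (((1 + x) ^ 2)⁻¹ + 2 * ((1 + x) ^ 3)⁻¹)

theorem expSqTail_pos {x : ℝ} (hx : 0 ≤ x) : 0 < expSqTail x := by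
  unfold expSqTail
  positivity

theorem expSqDensity_nonneg {x : ℝ} (hx : 0 ≤ x) : 0 ≤ expSqDensity x := by
  unfold expSqDensity
  positivity

theorem measurable_expSqDensity : Measurable expSqDensity := by
  unfold expSqDensity
  fun_prop

theorem hasDerivAt_neg_expSqTail {x : ℝ} (hx : 0 ≤ x) :
    HasDerivAt (fun x => -expSqTail x) (expSqDensity x) x := by
  have h1 : HasDerivAt (fun x : ℝ => Real.exp (-x)) (Real.exp (-x) * -1) x :=
    (Real.hasDerivAt_exp _).comp x (hasDerivAt_neg x)
  have h2 : HasDerivAt (fun x : ℝ => (1 + x) ^ 2) (2 * (1 + x)) x := by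
    simpa using ((hasDerivAt_id x).const_add 1).fun_pow 2
  have h3 := (h1.div h2 (by positivity)).neg
  refine h3.congr_deriv ?_
  unfold expSqDensity
  field_simp
  ring

theorem tendsto_expSqTail : Tendsto expSqTail atTop (𝓝 0) := by
  refine squeeze_zero' ?_ ?_ (Real.tendsto_exp_neg_atTop_nhds_zero)
  · filter_upwards [eventually_ge_atTop 0] with x hx
    exact (expSqTail_pos hx).le
  · filter_upwards [eventually_ge_atTop 0] with x hx
    refine div_le_self (Real.exp_pos _).le ?_
    nlinarith

theorem lintegral_expSqDensity {x : ℝ} (hx : 0 ≤ x) :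
    ∫⁻ y in Ioi x, ENNReal.ofReal (expSqDensity y) = ENNReal.ofReal (expSqTail x) := by
  have hd : ∀ y ∈ Ici x, HasDerivAt (fun x => -expSqTail x) (expSqDensity y) y := fun y hy =>
    hasDerivAt_neg_expSqTail (hx.trans hy)
  have hn : ∀ y ∈ Ioi x, 0 ≤ expSqDensity y := fun y hy =>
    expSqDensity_nonneg (hx.trans (le_of_lt hy))
  have ht : Tendsto (fun x => -expSqTail x) atTop (𝓝 0) := by
    simpa using tendsto_expSqTail.neg
  rw [← ofReal_integral_eq_lintegral_ofReal (integrableOn_Ioi_deriv_of_nonneg' hd hn ht)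
    ((ae_restrict_iff' measurableSet_Ioi).2 (Eventually.of_forall hn)),
    integral_Ioi_of_hasDerivAt_of_nonneg' hd hn ht, zero_sub, neg_neg]

/-- The distribution with tail `x ↦ e⁻ˣ / (1 + x)²` on `[0, ∞)`. -/
def expSqMeasure : Measure ℝ :=
  (volume.restrict (Ioi 0)).withDensity fun x => ENNReal.ofReal (expSqDensity x)

theorem expSqMeasure_apply {s : Set ℝ} (hs : MeasurableSet s) :
    expSqMeasure s = ∫⁻ y in s ∩ Ioi 0, ENNReal.ofReal (expSqDensity y) := by
  rw [expSqMeasure, withDensity_apply _ hs, Measure.restrict_restrict hs]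

theorem expSqMeasure_Ioi {x : ℝ} (hx : 0 ≤ x) :
    expSqMeasure (Ioi x) = ENNReal.ofReal (expSqTail x) := by
  rw [expSqMeasure_apply measurableSet_Ioi, Ioi_inter_Ioi, sup_of_le_left hx,
    lintegral_expSqDensity hx]

/-- The law with tail `x ↦ e⁻ˣ / (1 + x)²` on `[0, ∞)`. -/
def expSqLaw : Law where
  law := expSqMeasure
  isProbabilityMeasure := ⟨by
    rw [expSqMeasure_apply MeasurableSet.univ, univ_inter, lintegral_expSqDensity le_rfl]
    simp [expSqTail]⟩
  support_nonneg := by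
    rw [expSqMeasure_apply measurableSet_Iio, Iio_inter_Ioi, Ioo_self, Measure.restrict_empty,
      lintegral_zero_measure]
  support_unbounded x := by
    refine lt_of_lt_of_le ?_ (measure_mono (Ioi_subset_Ioi (le_max_left x 0)))
    rw [expSqMeasure_Ioi (le_max_right x 0), ENNReal.ofReal_pos]
    exact expSqTail_pos (le_max_right x 0)

theorem expSqLaw_tail {x : ℝ} (hx : 0 ≤ x) : expSqLaw.tail x = expSqTail x := by
  rw [Law.tail, measureReal_def]
  change (expSqMeasure (Ioi x)).toReal = _
  rw [expSqMeasure_Ioi hx, ENNReal.toReal_ofReal (expSqTail_pos hx).le]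

theorem expSqLaw_mem_classL : expSqLaw ∈ classL 1 := by
  intro t _
  have hlim : Tendsto (fun x : ℝ => ((1 + t / (1 + x)) ^ 2)⁻¹) atTop (𝓝 1) := by
    have h1 : Tendsto (fun x : ℝ => t / (1 + x)) atTop (𝓝 0) :=
      tendsto_const_nhds.div_atTop (tendsto_atTop_add_const_left _ _ tendsto_id)
    simpa using ((h1.const_add 1).pow 2).inv₀ (by norm_num)
  refine (isEquivalent_iff_tendsto_one (Eventually.of_forall fun x =>
    (mul_pos (Real.exp_pos _) (expSqLaw.tail_pos x)).ne')).2 (hlim.congr' ?_)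
  filter_upwards [eventually_ge_atTop 0, eventually_ge_atTop (-t)] with x hx hxt
  have h1 : 0 < 1 + x := by linarith
  have h2 : 0 < 1 + (x + t) := by linarith
  simp only [Pi.div_apply, expSqLaw_tail hx, expSqLaw_tail (show 0 ≤ x + t by linarith), expSqTail]
  rw [show Real.exp (-(x + t)) = Real.exp (-1 * t) * Real.exp (-x) by
    rw [← Real.exp_add]; ring_nf]
  have h3 : 1 + t / (1 + x) = (1 + (x + t)) / (1 + x) := by
    field_simp
    ring
  rw [h3]
  field_simp

theorem integrable_exp_expSqLaw : Integrable (fun y => Real.exp (1 * y)) expSqLaw.law := by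
  change Integrable _ ((volume.restrict (Ioi 0)).withDensity _)
  rw [integrable_withDensity_iff measurable_expSqDensity.ennreal_ofReal
    (Eventually.of_forall fun _ => ENNReal.ofReal_lt_top)]
  -- Tilting by `exp y` cancels the exponential in the density, and the rational function left over
  -- has an explicit antiderivative.
  have hd : ∀ y ∈ Ici (0 : ℝ), HasDerivAt (fun x : ℝ => -(1 + x)⁻¹ - ((1 + x) ^ 2)⁻¹)
      (((1 + y) ^ 2)⁻¹ + 2 * ((1 + y) ^ 3)⁻¹) y := by
    intro y hy
    have hy : 0 < 1 + y := by linarith [mem_Ici.1 hy]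
    have h1 : HasDerivAt (fun x : ℝ => 1 + x) 1 y := (hasDerivAt_id y).const_add 1
    refine ((h1.fun_inv hy.ne').neg.sub ((h1.fun_pow 2).fun_inv (pow_ne_zero 2 hy.ne'))).congr_deriv ?_
    field_simp
    ring
  have ht : Tendsto (fun x : ℝ => -(1 + x)⁻¹ - ((1 + x) ^ 2)⁻¹) atTop (𝓝 0) := by
    have h1 : Tendsto (fun x : ℝ => (1 + x)⁻¹) atTop (𝓝 0) :=
      tendsto_inv_atTop_zero.comp (tendsto_atTop_add_const_left _ _ tendsto_id)
    simpa using h1.neg.sub (h1.pow 2)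
  refine (integrableOn_Ioi_deriv_of_nonneg' hd (fun y hy => ?_) ht).congr_fun (fun y hy => ?_)
    measurableSet_Ioi
  · have : 0 < y := hy
    positivity
  · have hy : 0 < y := hy
    simp only
    rw [ENNReal.toReal_ofReal (expSqDensity_nonneg hy.le), expSqDensity, ← mul_assoc,
      ← Real.exp_add]
    simp

theorem expSqLaw_mem_convolutionEquivalent : expSqLaw ∈ convolutionEquivalent 1 := by
  -- For `a ≤ x / 2`, `1 + x ≤ 2 * (1 + (x - a))`, and squaring gives `4`.
  refine Law.mem_convolutionEquivalent (C := 4) expSqLaw_mem_classL integrable_exp_expSqLaw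
    (fun x a ha hax => ?_) ?_
  · have hx : 0 ≤ x := by linarith
    have h1 : 0 < 1 + (x - a) := by linarith
    rw [expSqLaw_tail hx, expSqLaw_tail (by linarith), expSqTail, expSqTail,
      show Real.exp (-(x - a)) = Real.exp (1 * a) * Real.exp (-x) by
        rw [← Real.exp_add]; ring_nf, div_le_iff₀ (by positivity)]
    have h2 : (1 + x) ^ 2 ≤ 4 * (1 + (x - a)) ^ 2 := by nlinarith
    calc Real.exp (1 * a) * Real.exp (-x)
        = Real.exp (1 * a) * (Real.exp (-x) / (1 + x) ^ 2) * (1 + x) ^ 2 := by field_simp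
      _ ≤ Real.exp (1 * a) * (Real.exp (-x) / (1 + x) ^ 2) * (4 * (1 + (x - a)) ^ 2) := by gcongr
      _ = _ := by ring
  · have hlim : Tendsto (fun x : ℝ => 16 * ((1 + x)⁻¹) ^ 2) atTop (𝓝 0) := by
      have h1 : Tendsto (fun x : ℝ => (1 + x)⁻¹) atTop (𝓝 0) :=
        tendsto_inv_atTop_zero.comp (tendsto_atTop_add_const_left _ _ tendsto_id)
      simpa using (h1.pow 2).const_mul 16
    refine squeeze_zero' (Eventually.of_forall fun x => ?_) ?_ hlim
    · have := expSqLaw.tail_pos x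
      positivity
    · filter_upwards [eventually_ge_atTop 0] with x hx
      rw [expSqLaw_tail hx, expSqLaw_tail (by positivity), expSqTail, expSqTail, div_pow,
        ← Real.exp_nat_mul, show ((2 : ℕ) : ℝ) * -(x / 2) = -x by push_cast; ring]
      have h2 : (1 + x) ^ 4 ≤ 16 * ((1 + x / 2) ^ 2) ^ 2 := by
        calc (1 + x) ^ 4 ≤ (2 * (1 + x / 2)) ^ 4 := by
              gcongr
              linarith
          _ = _ := by ring
      have he := Real.exp_pos (-x)
      calc Real.exp (-x) / ((1 + x / 2) ^ 2) ^ 2 / (Real.exp (-x) / (1 + x) ^ 2)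
          = (1 + x) ^ 4 / ((1 + x / 2) ^ 2) ^ 2 * ((1 + x)⁻¹) ^ 2 := by
            field_simp
        _ ≤ 16 * ((1 + x)⁻¹) ^ 2 := by
            gcongr
            rw [div_le_iff₀ (by positivity)]
            exact h2

/-! ### Constraints that exponential tails impose on the weight -/

namespace IsWeight

variable {g : ℕ → ℝ} {B : ℝ}

theorem exists_forall_mul_le (h : IsWeight g B) {F₁ : Law} {γ : ℝ} (hF₁ : F₁ ∈ classL γ)
    (hF : WeaklyTailEquivalent h.toLaw F₁) :
    ∃ C : ℝ, ∀ t : ℕ, ∀ᶠ m : ℕ in atTop, g (m + t) * g (m - t) ≤ C * g m ^ 2 := by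
  obtain ⟨C, hC, hCt⟩ := Law.exists_forall_tail_mul_le hF₁ hF
  refine ⟨C * h.tailConst ^ 2, fun t => ?_⟩
  have hnat : Tendsto (fun m : ℕ => (m : ℝ) - 1) atTop atTop :=
    tendsto_atTop_add_const_right _ _ tendsto_natCast_atTop_atTop
  -- The tail estimate is used at `m - 1`, because the tail there is comparable to the mass at `m`.
  -- The bound `m ≥ t + 1` makes the natural subtraction `m - t` exact and keeps its predecessor
  -- nonnegative.
  filter_upwards [hnat.eventually (hCt t), eventually_ge_atTop (t + 1)] with m hm hmt
  obtain ⟨k, rfl⟩ := Nat.exists_eq_add_of_le' hmt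
  have e1 : ((k + (t + 1) : ℕ) : ℝ) - 1 + t = (k + 2 * t : ℕ) := by push_cast; ring
  have e2 : ((k + (t + 1) : ℕ) : ℝ) - 1 - t = k := by push_cast; ring
  have e3 : ((k + (t + 1) : ℕ) : ℝ) - 1 = (k + t : ℕ) := by push_cast; ring
  rw [e1, e2, e3] at hm
  have h1 := h.mass_le_tail (k + 2 * t)
  have h2 := h.mass_le_tail k
  have h3 := h.tail_le_mass (k + t)
  have hT := h.toLaw.tail_pos (k + t : ℕ)
  have key : h.mass (k + 2 * t + 1) * h.mass (k + 1)
      ≤ C * (h.tailConst * h.mass (k + t + 1)) ^ 2 :=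
    calc _ ≤ _ := mul_le_mul h1 h2 (h.mass_pos _).le ((h.mass_pos _).le.trans h1)
      _ ≤ _ := hm
      _ ≤ _ := by gcongr
  have hZ := h.total_pos
  have he : Real.exp (-(k + 2 * t + 1 : ℕ)) * Real.exp (-(k + 1 : ℕ))
      = Real.exp (-(k + t + 1 : ℕ)) ^ 2 := by
    rw [← Real.exp_add, ← Real.exp_nat_mul]
    push_cast
    ring_nf
  rw [show k + (t + 1) + t = k + 2 * t + 1 by ring, show k + (t + 1) - t = k + 1 by omega,
    show k + (t + 1) = k + t + 1 by ring]
  have hE := Real.exp_pos (-(k + t + 1 : ℕ))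
  refine le_of_mul_le_mul_left ?_ (show 0 < Real.exp (-(k + t + 1 : ℕ)) ^ 2 / h.total ^ 2 by
    positivity)
  unfold mass at key
  calc _ = Real.exp (-(k + 2 * t + 1 : ℕ)) * g (k + 2 * t + 1) / h.total *
        (Real.exp (-(k + 1 : ℕ)) * g (k + 1) / h.total) := by
        rw [← he]
        field_simp
    _ ≤ _ := key
    _ = _ := by field_simp

/-- Masses are differences of consecutive tails, whose ratios tend to `r = exp (-γ)`. The expression
tends to `(r / r) * (1 - r)² / (1 - r)²`; `γ > 0` ensures `r ≠ 1`. -/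
theorem tendsto_mass_ratio (h : IsWeight g B) {γ : ℝ} (hγ : 0 < γ) (hF : h.toLaw ∈ classL γ) :
    Tendsto (fun m : ℕ => h.mass (m + 3) * h.mass (m + 1) / h.mass (m + 2) ^ 2) atTop (𝓝 1) := by
  set T : ℕ → ℝ := fun m => h.toLaw.tail m with hT
  have hTpos : ∀ m, 0 < T m := fun m => h.toLaw.tail_pos m
  set r := Real.exp (-γ * 1) with hr
  have hr0 : 0 < r := Real.exp_pos _
  have hr1 : r < 1 := by simpa [hr] using hγ
  have hρ : Tendsto (fun m : ℕ => T (m + 1) / T m) atTop (𝓝 r) := by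
    refine ((Law.tendsto_tail_div hF 1).comp tendsto_natCast_atTop_atTop).congr fun m => ?_
    simp [hT]
  have hρ1 := hρ.comp (tendsto_add_atTop_nat 1)
  have hρ2 := hρ.comp (tendsto_add_atTop_nat 2)
  have hlim := ((hρ1.div hρ hr0.ne').mul ((hρ2.const_sub 1).mul (hρ.const_sub 1))).div
    ((hρ1.const_sub 1).pow 2) (pow_ne_zero 2 (sub_pos.2 hr1).ne')
  have hone : r / r * ((1 - r) * (1 - r)) / (1 - r) ^ 2 = 1 := by
    have : 1 - r ≠ 0 := (sub_pos.2 hr1).ne'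
    field_simp
  rw [hone] at hlim
  refine hlim.congr fun m => ?_
  have hm : ∀ k, h.mass (k + 1) = T k - T (k + 1) := fun k => by
    have := h.tail_eq_add k
    simp only [hT]
    linarith
  have h0 := hTpos m
  have h1 := hTpos (m + 1)
  have h2 := hTpos (m + 2)
  have h12 : T (m + 1) - T (m + 2) ≠ 0 := by
    rw [← hm]
    exact (h.mass_pos _).ne'
  simp only [Pi.div_apply, Function.comp_apply, hm (m + 2), hm m, hm (m + 1),
    show m + 1 + 1 = m + 2 by ring, show m + 2 + 1 = m + 3 by ring]
  have e1 : 1 - T (m + 2) / T (m + 1) = (T (m + 1) - T (m + 2)) / T (m + 1) := by field_simp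
  rw [e1]
  field_simp

end IsWeight

/-! ### A light-tailed law equivalent to a convolution equivalent one -/

/-- A two-periodic modulation of the sequence `(1 + k)⁻²`. -/
def periodicWeight (k : ℕ) : ℝ := (2 + (-1) ^ k) / (1 + k) ^ 2

theorem one_le_two_add_neg_one_pow (k : ℕ) : (1 : ℝ) ≤ 2 + (-1) ^ k := by
  rcases neg_one_pow_eq_or ℝ k with h | h <;> rw [h] <;> norm_num

theorem two_add_neg_one_pow_le (k : ℕ) : (2 : ℝ) + (-1) ^ k ≤ 3 := by
  rcases neg_one_pow_eq_or ℝ k with h | h <;> rw [h] <;> norm_num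

theorem le_periodicWeight (k : ℕ) : 1 / (1 + k : ℝ) ^ 2 ≤ periodicWeight k := by
  unfold periodicWeight
  gcongr
  exact one_le_two_add_neg_one_pow k

theorem periodicWeight_le (k : ℕ) : periodicWeight k ≤ 3 / (1 + k : ℝ) ^ 2 := by
  unfold periodicWeight
  gcongr
  exact two_add_neg_one_pow_le k

/-- The constant is `36 = 3 * 3 * 4`: two oscillating numerators, and `1 + a + b ≤ 2 * (1 + a)`
squared. -/
theorem isWeight_periodicWeight : IsWeight periodicWeight 36 where
  pos k := lt_of_lt_of_le (by positivity) (le_periodicWeight k)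
  growth m j := by
    have h1 := le_periodicWeight m
    calc periodicWeight (m + j) ≤ 3 / (1 + (m + j : ℕ) : ℝ) ^ 2 := periodicWeight_le _
      _ ≤ 3 / (1 + m : ℝ) ^ 2 := by
        gcongr
        linarith
      _ ≤ 36 * 1 ^ 2 * (1 / (1 + m : ℝ) ^ 2) := by
        rw [one_pow, mul_one, mul_one_div]
        gcongr
        norm_num
      _ ≤ 36 * (1 + j) ^ 2 * periodicWeight m := by
        gcongr
        linarith [(Nat.cast_nonneg j : (0 : ℝ) ≤ j)]
  mul_le a b hab := by
    have hab : (b : ℝ) ≤ a := Nat.cast_le.2 hab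
    have hpos : 0 ≤ periodicWeight b := le_trans (by positivity) (le_periodicWeight b)
    calc periodicWeight a * periodicWeight b ≤ (3 / (1 + a : ℝ) ^ 2) * (3 / (1 + b : ℝ) ^ 2) := by
          gcongr
          · exact periodicWeight_le a
          · exact periodicWeight_le b
      _ = 36 * ((1 + b : ℝ) ^ 2)⁻¹ * (1 / (2 * (1 + a : ℝ)) ^ 2) := by field_simp; norm_num
      _ ≤ 36 * ((1 + b : ℝ) ^ 2)⁻¹ * (1 / (1 + (a + b : ℕ) : ℝ) ^ 2) := by
          gcongr
          push_cast
          linarith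
      _ ≤ _ := by
          gcongr
          exact le_periodicWeight (a + b)

/-- The lattice law with mass function proportional to `e⁻ᵏ (2 + (-1)ᵏ) / (1 + k)²`. -/
def periodicLaw : Law := isWeight_periodicWeight.toLaw

theorem periodicLaw_notMem_classL {γ : ℝ} (hγ : 0 < γ) : periodicLaw ∉ classL γ := by
  intro hF
  have hlim := isWeight_periodicWeight.tendsto_mass_ratio hγ hF
  have heven : Tendsto (fun j : ℕ => 2 * j) atTop atTop :=
    tendsto_id.const_mul_atTop' two_pos
  -- Along even `m` the outer masses carry the numerator `1` and the middle one `3`, so the ratio is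
  -- close to `1 / 9`. The crude bound `1 / 2` already contradicts the limit `1`.
  have hle := le_of_tendsto' (hlim.comp heven) (b := 1 / 2) fun j => ?_
  · norm_num at hle
  · have hZ := isWeight_periodicWeight.total_pos
    have he : Real.exp (-(2 * j + 3 : ℕ)) * Real.exp (-(2 * j + 1 : ℕ))
        = Real.exp (-(2 * j + 2 : ℕ)) ^ 2 := by
      rw [← Real.exp_add, ← Real.exp_nat_mul]
      push_cast
      ring_nf
    have hE := Real.exp_pos (-(2 * j + 2 : ℕ))
    have p1 : periodicWeight (2 * j + 1) = 1 / (2 * j + 2) ^ 2 := by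
      simp only [periodicWeight, pow_succ, pow_mul]
      push_cast
      norm_num
      ring
    have p2 : periodicWeight (2 * j + 2) = 3 / (2 * j + 3) ^ 2 := by
      simp only [periodicWeight, pow_succ, pow_mul]
      push_cast
      norm_num
      ring
    have p3 : periodicWeight (2 * j + 3) = 1 / (2 * j + 4) ^ 2 := by
      simp only [periodicWeight, pow_succ, pow_mul]
      push_cast
      norm_num
      ring
    have hj : (0 : ℝ) ≤ j := Nat.cast_nonneg j
    simp only [Function.comp_apply, IsWeight.mass]
    rw [div_le_iff₀ (by rw [p2]; positivity)]
    have hr : (1 / (2 * j + 4) ^ 2 : ℝ) * (1 / (2 * j + 2) ^ 2)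
        ≤ 1 / 2 * (3 / (2 * j + 3) ^ 2) ^ 2 := by
      rw [one_div_mul_one_div, div_pow, mul_div, div_le_div_iff₀ (by positivity) (by positivity)]
      have : (2 * j + 3 : ℝ) ^ 2 ≤ 2 * ((2 * j + 4) * (2 * j + 2)) := by nlinarith
      calc (1 : ℝ) * ((2 * j + 3) ^ 2) ^ 2 ≤ 1 * (2 * ((2 * j + 4) * (2 * j + 2))) ^ 2 := by gcongr
        _ ≤ _ := by
          have : 0 ≤ ((2 * j + 4 : ℝ) * (2 * j + 2)) ^ 2 := by positivity
          linarith
    calc _ = Real.exp (-(2 * j + 2 : ℕ)) ^ 2 / isWeight_periodicWeight.total ^ 2 *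
          (1 / (2 * j + 4) ^ 2 * (1 / (2 * j + 2) ^ 2)) := by
          rw [← he, p1, p3]
          field_simp
      _ ≤ Real.exp (-(2 * j + 2 : ℕ)) ^ 2 / isWeight_periodicWeight.total ^ 2 *
          (1 / 2 * (3 / (2 * j + 3) ^ 2) ^ 2) := by gcongr
      _ = _ := by
          rw [p2]
          field_simp

theorem weaklyTailEquivalent_periodicLaw : WeaklyTailEquivalent periodicLaw expSqLaw := by
  set h := isWeight_periodicWeight with hdef
  have hZ := h.total_pos
  have hV := h.tailConst_pos
  constructor
  · refine IsBigO.of_bound (h.tailConst * (3 / h.total)) ?_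
    filter_upwards [eventually_ge_atTop 0] with x hx
    rw [Real.norm_of_nonneg (Law.tail_pos _ _).le, Real.norm_of_nonneg (Law.tail_pos _ _).le,
      expSqLaw_tail hx]
    have hfl := Nat.lt_floor_add_one x
    calc periodicLaw.tail x = periodicLaw.tail ⌊x⌋₊ := h.tail_floor hx
      _ ≤ h.tailConst * h.mass (⌊x⌋₊ + 1) := h.tail_le_mass _
      _ ≤ h.tailConst * (3 / h.total * expSqTail x) := by
        gcongr
        rw [IsWeight.mass, div_mul_eq_mul_div]
        refine div_le_div_of_nonneg_right ?_ hZ.le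
        calc _ ≤ Real.exp (-x) * (3 / (1 + x) ^ 2) := by
              refine mul_le_mul (Real.exp_le_exp.2 ?_) ((periodicWeight_le _).trans ?_)
                (h.pos _).le (Real.exp_pos _).le
              · push_cast
                linarith
              · push_cast
                gcongr
          _ = _ := by
              rw [expSqTail]
              ring
      _ = _ := by ring
  · refine IsBigO.of_bound (4 * Real.exp 1 * h.total) ?_
    filter_upwards [eventually_ge_atTop 0] with x hx
    rw [Real.norm_of_nonneg (Law.tail_pos _ _).le, Real.norm_of_nonneg (Law.tail_pos _ _).le,
      expSqLaw_tail hx]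
    have hfl := Nat.floor_le hx
    have hle : h.mass (⌊x⌋₊ + 1) ≤ periodicLaw.tail x := by
      rw [periodicLaw, h.tail_floor hx]
      exact h.mass_le_tail _
    refine le_trans ?_ (mul_le_mul_of_nonneg_left hle (by positivity))
    calc expSqTail x = 4 * Real.exp 1 * (Real.exp (-(x + 1)) * (1 / (2 * (1 + x)) ^ 2)) := by
          rw [expSqTail, show -x = 1 + -(x + 1) by ring, Real.exp_add]
          field_simp
          norm_num
      _ ≤ 4 * Real.exp 1 * (Real.exp (-(⌊x⌋₊ + 1 : ℕ)) * periodicWeight (⌊x⌋₊ + 1)) := by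
          gcongr
          · push_cast
            linarith
          · refine le_trans ?_ (le_periodicWeight _)
            gcongr
            push_cast
            linarith
      _ = _ := by
          rw [IsWeight.mass]
          field_simp

/-! ### A light-tailed law not equivalent to any convolution equivalent one -/

/-- The distance to the set of powers of two. -/
def powDist (k : ℕ) : ℝ := Metric.infDist (k : ℝ) (range fun n : ℕ => (2 : ℝ) ^ n)

theorem powDist_nonneg (k : ℕ) : 0 ≤ powDist k := Metric.infDist_nonneg

theorem powDist_le_add_dist (k m : ℕ) : powDist k ≤ powDist m + |(k : ℝ) - m| :=
  Metric.infDist_le_infDist_add_dist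

theorem powDist_add_le (m j : ℕ) : powDist (m + j) ≤ powDist m + j := by
  have := powDist_le_add_dist (m + j) m
  simpa using this

theorem powDist_le_add (m j : ℕ) : powDist m ≤ powDist (m + j) + j := by
  have := powDist_le_add_dist m (m + j)
  simpa using this

theorem powDist_two_pow (n : ℕ) : powDist (2 ^ n) = 0 :=
  Metric.infDist_zero_of_mem ⟨n, by simp⟩

theorem powDist_le (k : ℕ) : powDist k ≤ 1 + k := by
  have h := powDist_le_add_dist k (2 ^ 0)
  rw [powDist_two_pow] at h
  have hk : |(k : ℝ) - (2 ^ 0 : ℕ)| ≤ 1 + k := by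
    rw [abs_le]
    push_cast
    constructor <;> linarith [(Nat.cast_nonneg k : (0 : ℝ) ≤ k)]
  linarith

theorem le_powDist {k : ℕ} {t : ℝ} (h : ∀ n : ℕ, t ≤ |(k : ℝ) - 2 ^ n|) : t ≤ powDist k := by
  refine (Metric.le_infDist (range_nonempty _)).2 ?_
  rintro _ ⟨n, rfl⟩
  exact h n

/-- The condition on `t` keeps `2 ^ n` the nearest power of two, here and in
`le_powDist_two_pow_sub`, where the competitor `2 ^ (n - 1)` makes the factor `4` necessary. -/
theorem le_powDist_two_pow_add {n t : ℕ} (h : 4 * t ≤ 2 ^ n) : (t : ℝ) ≤ powDist (2 ^ n + t) := by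
  have h : 4 * (t : ℝ) ≤ 2 ^ n := by exact_mod_cast h
  refine le_powDist fun k => ?_
  push_cast
  rcases le_or_gt k n with hk | hk
  · have : (2 : ℝ) ^ k ≤ 2 ^ n := pow_le_pow_right₀ one_le_two hk
    exact le_trans (by linarith) (le_abs_self _)
  · have : (2 : ℝ) ^ (n + 1) ≤ 2 ^ k := pow_le_pow_right₀ one_le_two hk
    rw [pow_succ] at this
    exact le_trans (by linarith) (neg_le_abs _)

theorem le_powDist_two_pow_sub {n t : ℕ} (h : 4 * t ≤ 2 ^ n) : (t : ℝ) ≤ powDist (2 ^ n - t) := by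
  have hle : t ≤ 2 ^ n := by omega
  have h : 4 * (t : ℝ) ≤ 2 ^ n := by exact_mod_cast h
  refine le_powDist fun k => ?_
  push_cast [Nat.cast_sub hle]
  rcases le_or_gt n k with hk | hk
  · have : (2 : ℝ) ^ n ≤ 2 ^ k := pow_le_pow_right₀ one_le_two hk
    exact le_trans (by linarith) (neg_le_abs _)
  · have : (2 : ℝ) ^ (k + 1) ≤ 2 ^ n := pow_le_pow_right₀ one_le_two hk
    rw [pow_succ] at this
    exact le_trans (by linarith) (le_abs_self _)

/-- A sequence with unbounded dips of a polynomial shape at the powers of two. -/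
def dipWeight (k : ℕ) : ℝ := (1 + powDist k) ^ 2 / (1 + k) ^ 6

theorem dipWeight_pos (k : ℕ) : 0 < dipWeight k := by
  have := powDist_nonneg k
  unfold dipWeight
  positivity

theorem dipWeight_le (k : ℕ) : dipWeight k ≤ 4 / (1 + k : ℝ) ^ 4 := by
  have h0 := powDist_nonneg k
  have h1 : 1 + powDist k ≤ 2 * (1 + k) := by
    linarith [powDist_le k, (Nat.cast_nonneg k : (0 : ℝ) ≤ k)]
  calc dipWeight k ≤ (2 * (1 + k : ℝ)) ^ 2 / (1 + k) ^ 6 := by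
        unfold dipWeight
        gcongr
    _ = _ := by
        field_simp
        norm_num

/-- Since `powDist` is 1-Lipschitz, shifting by `b` costs at most `(1 + b)²`. The decay `4 / (1 +
b)⁴` of the smaller factor pays for this and leaves the required `(1 + b)⁻²`, which is why the
denominator has exponent six. The constant is `256 = 2⁶ * 4`. -/
theorem isWeight_dipWeight : IsWeight dipWeight 256 where
  pos := dipWeight_pos
  growth m j := by
    have hm := powDist_nonneg m
    have hmj := powDist_nonneg (m + j)
    have hj : (0 : ℝ) ≤ j := Nat.cast_nonneg j
    have h1 : 1 + powDist (m + j) ≤ (1 + j) * (1 + powDist m) := by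
      nlinarith [powDist_add_le m j]
    have hpos := dipWeight_pos m
    calc dipWeight (m + j) ≤ ((1 + j) * (1 + powDist m)) ^ 2 / (1 + m : ℝ) ^ 6 := by
          unfold dipWeight
          gcongr
          linarith
      _ = 1 * (1 + j : ℝ) ^ 2 * dipWeight m := by
          unfold dipWeight
          ring
      _ ≤ 256 * (1 + j : ℝ) ^ 2 * dipWeight m := by
          gcongr
          norm_num
  mul_le a b hab := by
    have hab : (b : ℝ) ≤ a := Nat.cast_le.2 hab
    have ha := powDist_nonneg a
    have hs := powDist_nonneg (a + b)
    have hb : (0 : ℝ) ≤ b := Nat.cast_nonneg b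
    have h1 : 1 + powDist a ≤ (1 + b) * (1 + powDist (a + b)) := by
      nlinarith [powDist_le_add a b]
    have hpos := dipWeight_pos b
    have h2 : dipWeight a ≤ 64 * (1 + b : ℝ) ^ 2 * dipWeight (a + b) := by
      calc dipWeight a
          ≤ ((1 + b) * (1 + powDist (a + b))) ^ 2 / ((1 + (a + b : ℕ) : ℝ) / 2) ^ 6 := by
            unfold dipWeight
            gcongr
            push_cast
            linarith
        _ = _ := by
            unfold dipWeight
            field_simp
            norm_num
    have hpos' := dipWeight_pos (a + b)
    calc dipWeight a * dipWeight b
        ≤ (64 * (1 + b : ℝ) ^ 2 * dipWeight (a + b)) * (4 / (1 + b : ℝ) ^ 4) := by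
          gcongr
          exact dipWeight_le b
      _ = _ := by
          field_simp
          norm_num

/-- The lattice law with mass function proportional to `e⁻ᵏ dipWeight k`. -/
def dipLaw : Law := isWeight_dipWeight.toLaw

theorem not_weaklyTailEquivalent_dipLaw {F₁ : Law} {γ : ℝ} (hF₁ : F₁ ∈ classL γ) :
    ¬ WeaklyTailEquivalent dipLaw F₁ := by
  intro hF
  obtain ⟨C, hC⟩ := isWeight_dipWeight.exists_forall_mul_le hF₁ hF
  obtain ⟨t, ht⟩ := exists_nat_gt C
  have hpow : Tendsto (fun n : ℕ => 2 ^ n) atTop atTop :=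
    tendsto_pow_atTop_atTop_of_one_lt one_lt_two
  obtain ⟨n, hn, hn4⟩ :=
    ((hpow.eventually (hC t)).and (hpow.eventually (eventually_ge_atTop (4 * t)))).exists
  have hle : t ≤ 2 ^ n := by omega
  have h1 := le_powDist_two_pow_add hn4
  have h2 := le_powDist_two_pow_sub hn4
  have ht0 : (0 : ℝ) ≤ t := Nat.cast_nonneg t
  have htn : (t : ℝ) ≤ 2 ^ n := by exact_mod_cast hle
  unfold dipWeight at hn
  rw [powDist_two_pow] at hn
  push_cast [Nat.cast_sub hle] at hn
  set N : ℝ := 2 ^ n with hN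
  have hN0 : 0 < N := by positivity
  have hd : 0 < 1 + (N - t) := by linarith
  -- The denominators only help, as `(1 + N + t) * (1 + N - t) ≤ (1 + N)²`; the numerators
  -- contribute `(1 + t)²` each against `1` at the dip.
  have hlow : (1 + t : ℝ) ^ 4 / ((1 + N) ^ 6) ^ 2 ≤ C / ((1 + N) ^ 6) ^ 2 := by
    calc (1 + t : ℝ) ^ 4 / ((1 + N) ^ 6) ^ 2
        = (1 + t) ^ 2 * (1 + t) ^ 2 / ((1 + N) ^ 2) ^ 6 := by ring
      _ ≤ (1 + t) ^ 2 * (1 + t) ^ 2 / ((1 + (N + t)) * (1 + (N - t))) ^ 6 := by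
          gcongr
          nlinarith
      _ = (1 + t) ^ 2 / (1 + (N + t)) ^ 6 * ((1 + t) ^ 2 / (1 + (N - t)) ^ 6) := by
          rw [mul_pow, div_mul_div_comm]
      _ ≤ _ := by gcongr
      _ ≤ _ := hn
      _ = _ := by rw [add_zero, one_pow, div_pow, one_pow, mul_one_div]
  have h4 : (1 + t : ℝ) ^ 4 ≤ C := (div_le_div_iff_of_pos_right (by positivity)).1 hlow
  have h5 : (1 + t : ℝ) ≤ (1 + t) ^ 4 := le_self_pow₀ (by linarith) (by norm_num)
  linarith

/-! ### The witnesses -/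

theorem classS_of_pos {β : ℝ} (hβ : 0 < β) : classS β = convolutionEquivalent β :=
  if_neg hβ.ne'

theorem notMem_iUnion_classS {F : Law} (hS : F ∉ subexponential)
    (hL : ∀ γ : ℝ, 0 < γ → F ∉ classL γ) : F ∉ ⋃ β : ℝ, ⋃ _ : 0 ≤ β, classS β := by
  simp only [mem_iUnion, not_exists]
  intro β hβ hF
  rcases hβ.eq_or_lt with rfl | hβ
  · exact hS (by simpa [classS] using hF)
  · rw [classS_of_pos hβ] at hF
    exact hL β hβ hF.1

theorem iUnion_pos_subset_iUnion_nonneg :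
    (⋃ β : ℝ, ⋃ _ : 0 < β, classS β) ⊆ ⋃ β : ℝ, ⋃ _ : 0 ≤ β, classS β :=
  iUnion_mono fun _ => iUnion_mono' fun h => ⟨h.le, subset_rfl⟩

theorem periodicLaw_mem_classJLight₁ : periodicLaw ∈ classJLight₁ :=
  ⟨⟨isWeight_periodicWeight.toLaw_mem_classJ, isWeight_periodicWeight.toLaw_notMem_classK⟩,
    1, one_pos, expSqLaw, by
      rw [classS_of_pos one_pos]
      exact expSqLaw_mem_convolutionEquivalent, weaklyTailEquivalent_periodicLaw⟩

theorem periodicLaw_notMem_iUnion : periodicLaw ∉ ⋃ β : ℝ, ⋃ _ : 0 ≤ β, classS β :=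
  notMem_iUnion_classS isWeight_periodicWeight.toLaw_notMem_subexponential
    fun _ hγ => periodicLaw_notMem_classL hγ

theorem dipLaw_mem_classJLight₂ : dipLaw ∈ classJLight₂ := by
  refine ⟨⟨isWeight_dipWeight.toLaw_mem_classJ, isWeight_dipWeight.toLaw_notMem_classK⟩, ?_⟩
  rintro ⟨-, γ, hγ, F₁, hF₁, hF⟩
  rw [classS_of_pos hγ] at hF₁
  exact not_weaklyTailEquivalent_dipLaw hF₁.1 hF

/-- Weak tail equivalence is reflexive, so the law itself cannot lie in any `ℒ(γ)`. -/
theorem dipLaw_notMem_iUnion : dipLaw ∉ ⋃ β : ℝ, ⋃ _ : 0 ≤ β, classS β :=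
  notMem_iUnion_classS isWeight_dipWeight.toLaw_notMem_subexponential fun _ _ hL =>
    not_weaklyTailEquivalent_dipLaw hL (isTheta_refl _ _)

theorem classJLight_union : classJ ∩ classKᶜ = classJLight₁ ∪ classJLight₂ :=
  (union_sdiff_cancel inter_subset_left).symm

theorem classJHeavy_union : classJ ∩ classK = classJHeavy₁ ∪ classJHeavy₂ :=
  (union_sdiff_cancel inter_subset_left).symm

theorem classJ_eq_union : classJ = classJ₁ ∪ classJ₂ := by
  rw [classJ₁, classJ₂, union_union_union_comm, ← classJHeavy_union, ← classJLight_union,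
    ← inter_union_distrib_left, union_compl_self, inter_univ]

theorem disjoint_classJ₁_classJ₂ : Disjoint classJ₁ classJ₂ := by
  rw [Set.disjoint_left]
  rintro F (h | h) (h' | h')
  · exact h'.2 h
  · exact h'.1.2 h.1.2
  · exact h.1.2 h'.1.2
  · exact h'.2 h

end BigJump

end

theorem theorem1p1 :
    -- (i) the light-tailed part of the class, and the failure of the conjecture
    (BigJump.classJ ∩ BigJump.classKᶜ = BigJump.classJLight₁ ∪ BigJump.classJLight₂ ∧
      Disjoint BigJump.classJLight₁ BigJump.classJLight₂ ∧
      (BigJump.classJLight₁ \ ⋃ β : ℝ, ⋃ _ : 0 < β, BigJump.classS β).Nonempty ∧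
      (BigJump.classJLight₂ \ ⋃ β : ℝ, ⋃ _ : 0 < β, BigJump.classS β).Nonempty ∧
      BigJump.classJ ≠
        (BigJump.classJ ∩ BigJump.classK) ∪ ⋃ β : ℝ, ⋃ _ : 0 < β, BigJump.classS β) ∧
    -- (ii) the whole class
    (BigJump.classJ = BigJump.classJ₁ ∪ BigJump.classJ₂ ∧
      Disjoint BigJump.classJ₁ BigJump.classJ₂ ∧
      (BigJump.classJ₁ \ ⋃ β : ℝ, ⋃ _ : 0 ≤ β, BigJump.classS β).Nonempty ∧
      (BigJump.classJ₂ \ ⋃ β : ℝ, ⋃ _ : 0 ≤ β, BigJump.classS β).Nonempty) := by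
  have hA := BigJump.periodicLaw_mem_classJLight₁
  have hA' := fun h =>
    BigJump.periodicLaw_notMem_iUnion (BigJump.iUnion_pos_subset_iUnion_nonneg h)
  have hB := BigJump.dipLaw_mem_classJLight₂
  have hB' := fun h => BigJump.dipLaw_notMem_iUnion (BigJump.iUnion_pos_subset_iUnion_nonneg h)
  refine ⟨⟨BigJump.classJLight_union, disjoint_sdiff_right, ⟨_, hA, hA'⟩, ⟨_, hB, hB'⟩, ?_⟩,
    BigJump.classJ_eq_union, BigJump.disjoint_classJ₁_classJ₂,
    ⟨_, Or.inr hA, BigJump.periodicLaw_notMem_iUnion⟩,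
    ⟨_, Or.inr hB, BigJump.dipLaw_notMem_iUnion⟩⟩
  -- The first witness refutes the conjecture: it lies in `𝒥`, is light-tailed, and lies in no
  -- `𝒮(β)` with `β > 0`.
  intro h
  have hJ := hA.1.1
  rw [h] at hJ
  exact hJ.elim (fun hK => hA.1.2 hK.2) hA'
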